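/- Consider the Lucas exchange economy with $k$ assets: dividends $z=(z_1,\dots,z_k)^\top$ lie in a Borel set $Z\subseteq\mathbb{R}^k_+$ and form a Markov process with stationary transition function $Q$ on $Z$; $\beta\in(0,1)$. Given a price function $p:Z\to\mathbb{R}^k_+$, initial holdings $x_0$ and initial state $z_0$, the consumer chooses measurable history-dependent consumption $c_t=c_t(z_0,\dots,z_t)\ge 0$ and holdings $x_{t+1}=x_{t+1}(z_0,\dots,z_t)\ge 0$ to maximize $\mathrm{E}\sum_{t\ge 0}\beta^t u(c_t)$ subject to $c_t+x_{t+1}^\top p(z_t)\le x_t^\top(z_t+p(z_t))$ for all histories starting at $z_0$ and all $t$. An equilibrium price is a continuous $p:Z\to\mathbb{R}^k_+$ such that, for every $z_0\in Z$ and with $x_0=\mathbf 1=(1,\dots,1)^\top$, the plan $x_{t+1}=\mathbf 1$, $c_t=\mathbf 1^\top z_t$ is optimal, with finite value. Assume that $u:[0,\infty)\to\mathbb{R}$ satisfies $u(0)=0$, is continuously differentiable (one-sidedly at $0$) with $u'(c)>0$ for all $c\ge 0$, and is strictly concave; that there are $\gamma,\delta\ge 0$ with $c\,u'(c)\le\gamma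 c+\delta$ for all $c\ge 0$; and that there is $a>0$ with $u'(\mathbf 1^\top z)\ge a$ for all $z\in Z$. Assume moreover one of the following. (M1) $z_{t+1}=Bz_t+w_t$, where $B$ is a $k\times k$ matrix with nonnegative entries whose operator norm with respect to some norm on $\mathbb{R}^k$ is less than one, and the $w_t$ are i.i.d. random vectors with values in $\mathbb{R}^k_+$ and finite expectation. (M2) $z_{i,t+1}=z_{i,t}^{\rho_i}w_{i,t+1}$ for $i=1,\dots,k$ (with $0^0=1$), where $0\le\rho_i\le 1$, the $w_t$ are i.i.d. random vectors with values in $[1,\infty)^k$ and finite expectation, and $\mathrm{E}w_i<1/\beta$ for every $i$ with $\rho_i=1$. Then there are functions $\phi_1,\dots,\phi_k:Z\to\mathbb{R}$, integrable with respect to $Q(z,\cdot)$ for every $z\in Z$, that solve $$\phi_i(z)=h_i(z)+\beta\int_Z\phi_i(z')\,Q(z,dz'),\qquad h_i(z)=\beta\int_Z z_i'\,u'(\mathbf 1^\top z')\,Q(z,dz'),$$ for all $z\in Z$ and all $i$ (the integrals defining the $h_i$ being finite), and such that $p=(p_1,\dots,p_k)^\top$ with $p_i(z)=\phi_i(z)/u'(\mathbf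 1^\top z)$ is an equilibrium price. Moreover there are vectors $a_i\in\mathbb{R}^k_+$ and scalars $b_i>0$ with $p_i(z)\le a_i^\top z+b_i$ for all $z\in Z$ and $i=1,\dots,k$. -/

import Mathlib

open Set MeasureTheory ProbabilityTheory
open scoped ENNReal

/-! ### The Lucas exchange economy

Dividend vectors live in a set `Z ⊆ ℝᵏ`, a history `z^t = (z_0, …, z_t)` is a function
`Finset.Iic t → Z`, and `Q` is the transition function of the dividend process. -/

namespace Lucas

noncomputable section

variable {k : ℕ} {Z : Set (Fin k → ℝ)}

/-- The aggregate dividend `𝟏ᵀ z`. -/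
def total (z : Fin k → ℝ) : ℝ := ∑ i, z i

/-- Marginal utility on `[0, ∞)`; at `0` this is the right derivative. -/
def marginal (u : ℝ → ℝ) (c : ℝ) : ℝ := derivWithin u (Ici 0) c

/-- The law of the whole dividend path `(z_0, z_1, …)` of the Markov chain with transition
function `Q` started at `z₀` (Ionescu-Tulcea). -/
def pathLaw (Q : Kernel Z Z) [IsMarkovKernel Q] (z₀ : Z) : Measure (ℕ → Z) :=
  Kernel.traj (X := fun _ => Z)
    (fun n => Q.comap (fun h : Finset.Iic n → Z => h ⟨n, Finset.mem_Iic.2 le_rfl⟩)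
      (measurable_pi_apply _)) 0 (fun _ => z₀)

/-- Contingent plans: `cons t z^t` is the consumption `c_t` and `hold t z^t` is the vector
`x_{t+1}` of asset holdings chosen at the end of period `t`. -/
structure Plan (Z : Set (Fin k → ℝ)) where
  cons : (t : ℕ) → (Finset.Iic t → Z) → ℝ
  hold : (t : ℕ) → (Finset.Iic t → Z) → (Fin k → ℝ)

/-- The holdings `x_t` with which the consumer enters period `t`, from initial holdings `x₀`. -/
def Plan.entering (π : Plan Z) (x₀ : Fin k → ℝ) : (t : ℕ) → (Finset.Iic t → Z) → (Fin k → ℝ)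
  | 0, _ => x₀
  | t + 1, h => π.hold t (Preorder.frestrictLe₂ (π := fun _ => Z) (Nat.le_succ t) h)

/-- Feasibility at prices `p` from initial holdings `x₀` and initial state `z₀`: consumption and
holdings are measurable functions of the history, nonnegative, and satisfy the budget constraint
`c_t + x_{t+1}ᵀ p(z_t) ≤ x_tᵀ (z_t + p(z_t))` at every history starting at `z₀`. -/
structure Plan.Feasible (π : Plan Z) (p : Z → Fin k → ℝ) (x₀ : Fin k → ℝ) (z₀ : Z) : Prop where
  measurable_cons : ∀ t, Measurable (π.cons t)
  measurable_hold : ∀ t, Measurable (π.hold t)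
  cons_nonneg : ∀ t (h : Finset.Iic t → Z), h ⟨0, Finset.mem_Iic.2 (Nat.zero_le t)⟩ = z₀ →
    0 ≤ π.cons t h
  hold_nonneg : ∀ t (h : Finset.Iic t → Z), h ⟨0, Finset.mem_Iic.2 (Nat.zero_le t)⟩ = z₀ →
    ∀ i, 0 ≤ π.hold t h i
  budget : ∀ t (h : Finset.Iic t → Z), h ⟨0, Finset.mem_Iic.2 (Nat.zero_le t)⟩ = z₀ →
    let z : Z := h ⟨t, Finset.mem_Iic.2 le_rfl⟩
    π.cons t h + ∑ i, π.hold t h i * p z i ≤ ∑ i, π.entering x₀ t h i * ((z : Fin k → ℝ) i + p z i)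

/-- Expected discounted utility `E ∑ₜ βᵗ u(c_t)` of a plan, as an element of `[0, ∞]`
(for the nonnegative utility functions considered here). -/
def Plan.utility (π : Plan Z) (β : ℝ) (u : ℝ → ℝ) (Q : Kernel Z Z) [IsMarkovKernel Q] (z₀ : Z) :
    ℝ≥0∞ :=
  ∫⁻ ω, ∑' t : ℕ, ENNReal.ofReal
    (β ^ t * u (π.cons t (Preorder.frestrictLe (π := fun _ => Z) t ω))) ∂(pathLaw Q z₀)

/-- A plan is optimal if it is feasible, has finite value, and no feasible plan does better. -/
def Plan.Optimal (π : Plan Z) (β : ℝ) (u : ℝ → ℝ) (Q : Kernel Z Z) [IsMarkovKernel Q]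
    (p : Z → Fin k → ℝ) (x₀ : Fin k → ℝ) (z₀ : Z) : Prop :=
  π.Feasible p x₀ z₀ ∧ π.utility β u Q z₀ ≠ ⊤ ∧
    ∀ π' : Plan Z, π'.Feasible p x₀ z₀ → π'.utility β u Q z₀ ≤ π.utility β u Q z₀

/-- Market clearing: always hold exactly one unit of each asset and consume all dividends. -/
def clearingPlan (Z : Set (Fin k → ℝ)) : Plan Z where
  cons t h := total (h ⟨t, Finset.mem_Iic.2 le_rfl⟩ : Fin k → ℝ)
  hold _ _ := fun _ => 1

/-- A (stationary) equilibrium price function: it is continuous with values in `ℝᵏ₊`, and from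
every initial state the consumer who starts with one unit of each asset and takes the prices as
given finds it optimal to hold exactly one unit of each asset for ever. -/
structure IsEquilibriumPrice (β : ℝ) (u : ℝ → ℝ) (Q : Kernel Z Z) [IsMarkovKernel Q]
    (p : Z → Fin k → ℝ) : Prop where
  continuous : Continuous p
  nonneg : ∀ z i, 0 ≤ p z i
  optimal : ∀ z₀, (clearingPlan Z).Optimal β u Q p (fun _ => 1) z₀

/-- `h_i(z) = β ∫ z'_i u'(𝟏ᵀz') Q(z, dz')`. -/
def hFun (β : ℝ) (u : ℝ → ℝ) (Q : Kernel Z Z) (i : Fin k) (z : Z) : ℝ :=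
  β * ∫ z' : Z, (z' : Fin k → ℝ) i * marginal u (total (z' : Fin k → ℝ)) ∂(Q z)

/-- `φ` solves the functional equations `φ_i(z) = h_i(z) + β ∫ φ_i(z') Q(z, dz')`, all the
integrals being those of integrable functions. -/
def SolvesLucas (β : ℝ) (u : ℝ → ℝ) (Q : Kernel Z Z) (φ : Fin k → Z → ℝ) : Prop :=
  ∀ i z,
    Integrable (fun z' : Z => (z' : Fin k → ℝ) i * marginal u (total (z' : Fin k → ℝ))) (Q z) ∧
    Integrable (φ i) (Q z) ∧
    φ i z = hFun β u Q i z + β * ∫ z', φ i z' ∂(Q z)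

/-- Dividends follow `z_{t+1} = B z_t + w_t` with i.i.d. shocks of law `ν` on `ℝᵏ₊` with finite
expectation, where `B ≥ 0` entrywise and `B` has operator norm less than one with respect to some
norm `N` of `ℝᵏ`. -/
def LinearDividends (Q : Kernel Z Z) : Prop :=
  ∃ (B : Matrix (Fin k) (Fin k) ℝ) (ν : Measure (Fin k → ℝ)), IsProbabilityMeasure ν ∧
    (∀ i j, 0 ≤ B i j) ∧
    (∃ N : Seminorm ℝ (Fin k → ℝ), (∀ x, N x = 0 → x = 0) ∧
      ∃ q : ℝ, q < 1 ∧ ∀ x, N (B.mulVec x) ≤ q * N x) ∧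
    (∀ᵐ w ∂ν, ∀ i, 0 ≤ w i) ∧
    (∀ i, Integrable (fun w : Fin k → ℝ => w i) ν) ∧
    ∀ z : Z, (Q z).map Subtype.val = ν.map (fun w => B.mulVec (z : Fin k → ℝ) + w)

/-- Dividends follow `z_{i,t+1} = z_{i,t} ^ ρ_i * w_{i,t+1}` with i.i.d. shocks of law `ν` on
`[1, ∞)ᵏ` with finite expectation, where `0 ≤ ρ_i ≤ 1`, and `E w_i < 1 / β` if `ρ_i = 1`. -/
def LogLinearDividends (β : ℝ) (Q : Kernel Z Z) : Prop :=
  ∃ (ρ : Fin k → ℝ) (ν : Measure (Fin k → ℝ)), IsProbabilityMeasure ν ∧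
    (∀ i, 0 ≤ ρ i ∧ ρ i ≤ 1) ∧
    (∀ᵐ w ∂ν, ∀ i, 1 ≤ w i) ∧
    (∀ i, Integrable (fun w : Fin k → ℝ => w i) ν) ∧
    (∀ i, ρ i = 1 → ∫ w, w i ∂ν < 1 / β) ∧
    ∀ z : Z, (Q z).map Subtype.val = ν.map (fun w i => (z : Fin k → ℝ) i ^ ρ i * w i)

end

end Lucas

/-!
Let `V ≥ 1` be a weight dominating `𝟏ᵀz`, with `∫ V(z') Q(z, dz') ≤ r V(z)` and `β r < 1`. Then
`φ ↦ h_i + β ∫ φ(z') Q(·, dz')` contracts the functions `V v` with `v` bounded and continuous, in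
the norm of `v`, and its fixed point `φ_i` is nonnegative and at most a multiple of `V`.

At prices `φ_i / u'(𝟏ᵀz)` a budget constraint multiplied by `u'(𝟏ᵀz)` becomes a statement about
values `φ_i` and, since `u` lies below its tangent at `𝟏ᵀz`, bounds the utility gained in one period
over the clearing plan by the loss of portfolio value. By the functional equation these bounds
telescope, and `E βᵗ V(z_t) ≤ (β r)ᵗ V(z_0) → 0` is the transversality condition.

In both models `V(z) = Aᵀz + b` is such a weight: for linear dividends `A = 𝟏ᵀ(I + B + ⋯ + Bᵐ⁻¹)`
with `m` so large that `𝟏ᵀBᵐ ≤ 𝟏ᵀ`, which gives `AᵀB ≤ Aᵀ`; for log-linear dividends `A = 𝟏`,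
because `x ^ ρ` with `ρ < 1` lies below lines of arbitrarily small slope.
-/

namespace Lucas

open Filter Topology
open scoped BoundedContinuousFunction Matrix

section Dominated

variable {X : Type*} [TopologicalSpace X] {V f g : X → ℝ}

/-- The positive cone of the weighted space `C_V(X)`: continuous nonnegative functions that grow
at most like the weight `V`. -/
structure Dominated (V f : X → ℝ) : Prop where
  continuous : Continuous f
  nonneg : ∀ x, 0 ≤ f x
  exists_le : ∃ K, 0 ≤ K ∧ ∀ x, f x ≤ K * V x

theorem Dominated.exists_abs_le (hf : Dominated V f) : ∃ K, 0 ≤ K ∧ ∀ x, |f x| ≤ K * V x :=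
  hf.exists_le.imp fun _ hK => ⟨hK.1, fun x => (abs_of_nonneg (hf.nonneg x)).trans_le (hK.2 x)⟩

theorem Dominated.add (hf : Dominated V f) (hg : Dominated V g) :
    Dominated V fun x => f x + g x := by
  obtain ⟨K, hK, hfK⟩ := hf.exists_le
  obtain ⟨L, hL, hgL⟩ := hg.exists_le
  refine ⟨hf.continuous.add hg.continuous, fun x => add_nonneg (hf.nonneg x) (hg.nonneg x),
    K + L, add_nonneg hK hL, fun x => ?_⟩
  rw [add_mul]
  exact add_le_add (hfK x) (hgL x)

theorem Dominated.const_mul {c : ℝ} (hc : 0 ≤ c) (hf : Dominated V f) :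
    Dominated V fun x => c * f x := by
  obtain ⟨K, hK, hfK⟩ := hf.exists_le
  refine ⟨hf.continuous.const_mul c, fun x => mul_nonneg hc (hf.nonneg x), c * K, mul_nonneg hc hK,
    fun x => ?_⟩
  rw [mul_assoc]
  exact mul_le_mul_of_nonneg_left (hfK x) hc

theorem Dominated.sum {ι : Type*} (s : Finset ι) {f : ι → X → ℝ} (hf : ∀ i, Dominated V (f i)) :
    Dominated V fun x => ∑ i ∈ s, f i x := by
  classical
  induction s using Finset.induction_on with
  | empty =>
    exact ⟨continuous_const, fun _ => le_rfl, 0, le_rfl, fun _ => (zero_mul _).ge⟩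
  | insert i s hi ih => simpa only [Finset.sum_insert hi] using (hf i).add ih

end Dominated

section WeightedFeller

variable {X : Type*} [TopologicalSpace X] [MeasurableSpace X]

/-- A weight `V ≥ 1` with geometric drift rate `r` for the transition function `Q`, whose
transition operator has the Feller property on the weighted space `C_V(X)`. -/
structure WeightedFeller (Q : Kernel X X) (V : X → ℝ) (r : ℝ) : Prop where
  continuous_weight : Continuous V
  one_le : ∀ x, 1 ≤ V x
  rate_nonneg : 0 ≤ r
  integrable_weight : ∀ x, Integrable V (Q x)
  drift : ∀ x, ∫ y, V y ∂Q x ≤ r * V x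
  continuous_integral : ∀ ⦃f : X → ℝ⦄, Continuous f → ∀ K, (∀ x, |f x| ≤ K * V x) →
    Continuous fun x => ∫ y, f y ∂Q x

variable {Q : Kernel X X} {V f : X → ℝ} {r β : ℝ}

namespace WeightedFeller

theorem weight_pos (hV : WeightedFeller Q V r) (x : X) : 0 < V x :=
  one_pos.trans_le (hV.one_le x)

theorem abs_weight_mul_le (hV : WeightedFeller Q V r) (v : X →ᵇ ℝ) (x : X) :
    |V x * v x| ≤ ‖v‖ * V x := by
  rw [abs_mul, abs_of_pos (hV.weight_pos x), mul_comm]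
  exact mul_le_mul_of_nonneg_right (v.norm_coe_le_norm x) (hV.weight_pos x).le

theorem continuous_weight_mul (hV : WeightedFeller Q V r) (v : X →ᵇ ℝ) :
    Continuous fun x => V x * v x :=
  hV.continuous_weight.mul v.continuous

theorem abs_integral_le (hV : WeightedFeller Q V r) {K : ℝ} (hK : 0 ≤ K)
    (hfK : ∀ x, |f x| ≤ K * V x) (x : X) : |∫ y, f y ∂Q x| ≤ K * r * V x :=
  calc ‖∫ y, f y ∂Q x‖ ≤ ∫ y, K * V y ∂Q x :=
        norm_integral_le_of_norm_le ((hV.integrable_weight x).const_mul K) (.of_forall hfK)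
    _ = K * ∫ y, V y ∂Q x := integral_const_mul _ _
    _ ≤ K * (r * V x) := mul_le_mul_of_nonneg_left (hV.drift x) hK
    _ = K * r * V x := (mul_assoc _ _ _).symm

theorem dominated_integral (hV : WeightedFeller Q V r) (hf : Dominated V f) :
    Dominated V fun x => ∫ y, f y ∂Q x := by
  obtain ⟨K, hK, hfK⟩ := hf.exists_abs_le
  exact ⟨hV.continuous_integral hf.continuous K hfK, fun x => integral_nonneg hf.nonneg, K * r,
    mul_nonneg hK hV.rate_nonneg,
    fun x => (le_abs_self _).trans (hV.abs_integral_le hK hfK x)⟩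

variable [OpensMeasurableSpace X]

theorem integrable_of_abs_le (hV : WeightedFeller Q V r) (hf : Continuous f) {K : ℝ}
    (hK : ∀ x, |f x| ≤ K * V x) (x : X) : Integrable f (Q x) :=
  ((hV.integrable_weight x).const_mul K).mono' hf.measurable.aestronglyMeasurable
    (.of_forall hK)

theorem integrable (hV : WeightedFeller Q V r) (hf : Dominated V f) (x : X) :
    Integrable f (Q x) :=
  let ⟨_, _, hK⟩ := hf.exists_abs_le
  hV.integrable_of_abs_le hf.continuous hK x

/-- The operator `φ ↦ h + β ∫ φ dQ` in the coordinate `v = φ / V`, which turns the weighted sup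
norm into the sup norm. -/
noncomputable def normalizedOperator (hV : WeightedFeller Q V r) (β : ℝ) {h : X → ℝ}
    (hh : Dominated V h) (v : X →ᵇ ℝ) : X →ᵇ ℝ :=
  BoundedContinuousFunction.ofNormedAddCommGroup
    (fun x => (h x + β * ∫ y, V y * v y ∂Q x) / V x)
    ((hh.continuous.add ((hV.continuous_integral (hV.continuous_weight_mul v) ‖v‖
      (hV.abs_weight_mul_le v)).const_mul β)).div hV.continuous_weight
        fun x => (hV.weight_pos x).ne')
    (hh.exists_abs_le.choose + |β| * (‖v‖ * r))
    fun x => by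
      rw [norm_div, Real.norm_of_nonneg (hV.weight_pos x).le, div_le_iff₀ (hV.weight_pos x),
        add_mul]
      refine (norm_add_le _ _).trans (add_le_add (hh.exists_abs_le.choose_spec.2 x) ?_)
      rw [norm_mul, Real.norm_eq_abs, mul_assoc]
      exact mul_le_mul_of_nonneg_left
        (hV.abs_integral_le (norm_nonneg v) (hV.abs_weight_mul_le v) x) (abs_nonneg β)

theorem contracting_normalizedOperator (hV : WeightedFeller Q V r) (hβ : 0 ≤ β)
    (hβr : β * r < 1) {h : X → ℝ} (hh : Dominated V h) :
    ContractingWith ⟨β * r, mul_nonneg hβ hV.rate_nonneg⟩ (hV.normalizedOperator β hh) := by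
  refine ⟨hβr, LipschitzWith.of_dist_le_mul fun v w =>
    (BoundedContinuousFunction.dist_le (mul_nonneg (mul_nonneg hβ hV.rate_nonneg) dist_nonneg)).2
      fun x => ?_⟩
  have hint (v : X →ᵇ ℝ) : Integrable (fun y => V y * v y) (Q x) :=
    hV.integrable_of_abs_le (hV.continuous_weight_mul v) (hV.abs_weight_mul_le v) x
  have hdiff : hV.normalizedOperator β hh v x - hV.normalizedOperator β hh w x
      = β * (∫ y, V y * (v - w) y ∂Q x) / V x := by
    have : ∫ y, V y * (v - w) y ∂Q x = ∫ y, V y * v y ∂Q x - ∫ y, V y * w y ∂Q x := by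
      rw [← integral_sub (hint v) (hint w)]
      simp only [BoundedContinuousFunction.coe_sub, Pi.sub_apply, mul_sub]
    rw [this]
    simp only [normalizedOperator, BoundedContinuousFunction.coe_ofNormedAddCommGroup]
    ring
  rw [Real.dist_eq, hdiff, abs_div, abs_mul, abs_of_nonneg hβ, abs_of_pos (hV.weight_pos x),
    div_le_iff₀ (hV.weight_pos x), dist_eq_norm]
  calc β * |∫ y, V y * (v - w) y ∂Q x| ≤ β * (‖v - w‖ * r * V x) :=
        mul_le_mul_of_nonneg_left
          (hV.abs_integral_le (norm_nonneg _) (hV.abs_weight_mul_le (v - w)) x) hβ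
    _ = β * r * ‖v - w‖ * V x := by ring

theorem exists_fixedPoint_nonneg (hV : WeightedFeller Q V r) (hβ : 0 ≤ β) (hβr : β * r < 1)
    {h : X → ℝ} (hh : Dominated V h) :
    ∃ v : X →ᵇ ℝ, hV.normalizedOperator β hh v = v ∧ ∀ x, 0 ≤ v x := by
  have hcontr := hV.contracting_normalizedOperator hβ hβr hh
  refine ⟨hcontr.fixedPoint, hcontr.fixedPoint_isFixedPt, fun x => ?_⟩
  have hmaps : MapsTo (hV.normalizedOperator β hh) {v | ∀ x, 0 ≤ v x} {v | ∀ x, 0 ≤ v x} :=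
    fun v hv x => div_nonneg (add_nonneg (hh.nonneg x) (mul_nonneg hβ (integral_nonneg fun y =>
      mul_nonneg (hV.weight_pos y).le (hv y)))) (hV.weight_pos x).le
  have heval := ((BoundedContinuousFunction.lipschitz_eval_const x).continuous.tendsto _).comp
    (hcontr.tendsto_iterate_fixedPoint (0 : X →ᵇ ℝ))
  exact ge_of_tendsto' heval fun n => hmaps.iterate n (fun _ => le_rfl) x

theorem exists_dominated_eq_add_integral (hV : WeightedFeller Q V r) (hβ : 0 ≤ β)
    (hβr : β * r < 1) {h : X → ℝ} (hh : Dominated V h) :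
    ∃ φ, Dominated V φ ∧ ∀ x, φ x = h x + β * ∫ y, φ y ∂Q x := by
  obtain ⟨v, hv, hv0⟩ := hV.exists_fixedPoint_nonneg hβ hβr hh
  refine ⟨fun x => V x * v x, ⟨hV.continuous_weight_mul v,
    fun x => mul_nonneg (hV.weight_pos x).le (hv0 x), ‖v‖, norm_nonneg v,
    fun x => (le_abs_self _).trans (hV.abs_weight_mul_le v x)⟩, fun x => ?_⟩
  calc V x * v x = V x * hV.normalizedOperator β hh v x := by rw [hv]
    _ = h x + β * ∫ y, V y * v y ∂Q x := mul_div_cancel₀ _ (hV.weight_pos x).ne'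

end WeightedFeller

end WeightedFeller

variable {k : ℕ} {Z : Set (Fin k → ℝ)}

section Utility

/-- The utility functions of the economy: nonnegative, concave, continuously differentiable on
`[0, ∞)` and with positive marginal utility. -/
structure IsUtility (u : ℝ → ℝ) : Prop where
  nonneg_zero : 0 ≤ u 0
  contDiffOn : ContDiffOn ℝ 1 u (Ici 0)
  concaveOn : ConcaveOn ℝ (Ici 0) u
  marginal_pos : ∀ c, 0 ≤ c → 0 < marginal u c

theorem total_nonneg {z : Fin k → ℝ} (hz : ∀ i, 0 ≤ z i) : 0 ≤ total z :=
  Finset.sum_nonneg fun i _ => hz i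

theorem le_total {z : Fin k → ℝ} (hz : ∀ i, 0 ≤ z i) (i : Fin k) : z i ≤ total z :=
  Finset.single_le_sum (fun j _ => hz j) (Finset.mem_univ i)

theorem continuous_total : Continuous (total (k := k)) :=
  continuous_finsetSum _ fun i _ => continuous_apply i

namespace IsUtility

variable {u : ℝ → ℝ}

theorem le_tangent (hu : IsUtility u) {c y : ℝ} (hc : 0 ≤ c) (hy : 0 ≤ y) :
    u c ≤ u y + marginal u y * (c - y) := by
  have hder : HasDerivWithinAt u (marginal u y) (Ici 0) y :=
    (hu.contDiffOn.differentiableOn one_ne_zero y hy).hasDerivWithinAt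
  rcases lt_trichotomy c y with hcy | rfl | hyc
  · have := hu.concaveOn.le_slope_of_hasDerivWithinAt hc hy hcy hder
    rw [slope_def_field, le_div_iff₀ (sub_pos.2 hcy)] at this
    linarith
  · simp only [sub_self, mul_zero, add_zero, le_refl]
  · have := hu.concaveOn.slope_le_of_hasDerivWithinAt hy hc hyc hder
    rw [slope_def_field, div_le_iff₀ (sub_pos.2 hyc)] at this
    linarith

theorem nonneg (hu : IsUtility u) {c : ℝ} (hc : 0 ≤ c) : 0 ≤ u c := by
  have htangent := hu.le_tangent le_rfl hc
  have hslope := mul_nonneg (hu.marginal_pos c hc).le hc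
  linarith [hu.nonneg_zero]

theorem continuous_comp_total (hu : IsUtility u) (hZ : ∀ z ∈ Z, ∀ i, 0 ≤ z i) :
    Continuous fun z : Z => u (total (z : Fin k → ℝ)) :=
  hu.contDiffOn.continuousOn.comp_continuous (continuous_total.comp continuous_subtype_val)
    fun z => total_nonneg (hZ z z.2)

theorem continuous_marginal_total (hu : IsUtility u) (hZ : ∀ z ∈ Z, ∀ i, 0 ≤ z i) :
    Continuous fun z : Z => marginal u (total (z : Fin k → ℝ)) :=
  (hu.contDiffOn.continuousOn_derivWithin (uniqueDiffOn_Ici 0) le_rfl).comp_continuous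
    (continuous_total.comp continuous_subtype_val) fun z => total_nonneg (hZ z z.2)

theorem marginal_total_pos (hu : IsUtility u) (hZ : ∀ z ∈ Z, ∀ i, 0 ≤ z i) (z : Z) :
    0 < marginal u (total (z : Fin k → ℝ)) :=
  hu.marginal_pos _ (total_nonneg (hZ z z.2))

end IsUtility

/-- The dividend of asset `i` valued at the marginal utility of aggregate consumption; `h_i` is
its expected discounted value. -/
noncomputable def marginalPayoff (u : ℝ → ℝ) (i : Fin k) (z : Z) : ℝ :=
  (z : Fin k → ℝ) i * marginal u (total (z : Fin k → ℝ))

variable {u : ℝ → ℝ} {V : Z → ℝ}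

theorem IsUtility.dominated_comp_total (hu : IsUtility u) (hZ : ∀ z ∈ Z, ∀ i, 0 ≤ z i)
    (hV : ∀ z, 1 ≤ V z) (hVtotal : ∀ z : Z, total (z : Fin k → ℝ) ≤ V z) :
    Dominated V fun z : Z => u (total (z : Fin k → ℝ)) := by
  refine ⟨hu.continuous_comp_total hZ, fun z => hu.nonneg (total_nonneg (hZ z z.2)),
    u 0 + marginal u 0, add_nonneg hu.nonneg_zero (hu.marginal_pos 0 le_rfl).le, fun z => ?_⟩
  calc u (total (z : Fin k → ℝ))
      ≤ u 0 + marginal u 0 * (total (z : Fin k → ℝ) - 0) :=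
        hu.le_tangent (total_nonneg (hZ z z.2)) le_rfl
    _ ≤ u 0 * V z + marginal u 0 * V z := by
        rw [sub_zero]
        exact add_le_add (le_mul_of_one_le_right hu.nonneg_zero (hV z))
          (mul_le_mul_of_nonneg_left (hVtotal z) (hu.marginal_pos 0 le_rfl).le)
    _ = (u 0 + marginal u 0) * V z := (add_mul _ _ _).symm

theorem IsUtility.dominated_marginalPayoff (hu : IsUtility u) (hZ : ∀ z ∈ Z, ∀ i, 0 ≤ z i)
    (hV : ∀ z, 1 ≤ V z) (hVtotal : ∀ z : Z, total (z : Fin k → ℝ) ≤ V z) {γ δ : ℝ}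
    (hγδ : ∀ c, 0 ≤ c → c * marginal u c ≤ γ * c + δ) (i : Fin k) :
    Dominated V (marginalPayoff (Z := Z) u i) := by
  refine ⟨((continuous_apply i).comp continuous_subtype_val).mul
    (hu.continuous_marginal_total hZ), fun z => mul_nonneg (hZ z z.2 i)
    (hu.marginal_total_pos hZ z).le, |γ| + |δ|, add_nonneg (abs_nonneg γ) (abs_nonneg δ),
    fun z => ?_⟩
  have htotal := total_nonneg (hZ z z.2)
  calc marginalPayoff u i z
      ≤ total (z : Fin k → ℝ) * marginal u (total (z : Fin k → ℝ)) :=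
        mul_le_mul_of_nonneg_right (le_total (hZ z z.2) i) (hu.marginal_total_pos hZ z).le
    _ ≤ γ * total (z : Fin k → ℝ) + δ := hγδ _ htotal
    _ ≤ |γ| * V z + |δ| * V z := add_le_add
        ((mul_le_mul_of_nonneg_right (le_abs_self γ) htotal).trans
          (mul_le_mul_of_nonneg_left (hVtotal z) (abs_nonneg γ)))
        ((le_abs_self δ).trans (le_mul_of_one_le_right (abs_nonneg δ) (hV z)))
    _ = (|γ| + |δ|) * V z := (add_mul _ _ _).symm

end Utility

section PathLaw

/-- The history `z^t = (z_0, …, z_t)` of a dividend path. -/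
abbrev history (t : ℕ) (ω : ℕ → Z) : Finset.Iic t → Z :=
  Preorder.frestrictLe (π := fun _ => Z) t ω

/-- The transition function from histories `z^n` to the next state `z_{n+1}`, which sees only the
last state; `pathLaw` is the Ionescu-Tulcea measure of these kernels. -/
noncomputable def historyKernel (Q : Kernel Z Z) (n : ℕ) : Kernel (Finset.Iic n → Z) Z :=
  Q.comap (fun h => h ⟨n, Finset.mem_Iic.2 le_rfl⟩) (measurable_pi_apply _)

variable {Q : Kernel Z Z} [IsMarkovKernel Q]

instance (n : ℕ) : IsMarkovKernel (historyKernel Q n) :=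
  inferInstanceAs (IsMarkovKernel (Q.comap _ _))

variable (Q)

theorem pathLaw_eq_traj (z₀ : Z) :
    pathLaw Q z₀ = Kernel.traj (X := fun _ => Z) (historyKernel Q) 0 fun _ => z₀ :=
  rfl

instance (z₀ : Z) : IsProbabilityMeasure (pathLaw Q z₀) := by
  rw [pathLaw_eq_traj]; infer_instance

theorem pathLaw_start (z₀ : Z) : ∀ᵐ ω ∂pathLaw Q z₀, ω 0 = z₀ := by
  have hlaw : (pathLaw Q z₀).map (history 0) = Measure.dirac fun _ => z₀ := by
    rw [pathLaw_eq_traj, Kernel.traj_map_frestrictLe_apply, Kernel.partialTraj_self,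
      Kernel.id_apply]
  have hstart : ∀ᵐ h ∂(pathLaw Q z₀).map (history 0), h ⟨0, Finset.mem_Iic.2 le_rfl⟩ = z₀ := by
    rw [hlaw]
    exact (ae_dirac_iff (measurableSet_eq_fun (measurable_pi_apply _) measurable_const)).2 rfl
  exact ae_of_ae_map (Preorder.measurable_frestrictLe 0).aemeasurable hstart

theorem lintegral_pathLaw_succ (z₀ : Z) (t : ℕ)
    {F : (Finset.Iic t → Z) → Z → ℝ≥0∞} (hF : Measurable (Function.uncurry F)) :
    ∫⁻ ω, F (history t ω) (ω (t + 1)) ∂pathLaw Q z₀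
      = ∫⁻ ω, ∫⁻ z, F (history t ω) z ∂Q (ω t) ∂pathLaw Q z₀ := by
  have hlaw := congrArg (fun μ => ∫⁻ x, Function.uncurry F x ∂μ)
    (Kernel.partialTraj_compProd_eq_map_traj (X := fun _ => Z) (κ := historyKernel Q)
      (Nat.zero_le t) (x₀ := fun _ => z₀))
  beta_reduce at hlaw
  rw [lintegral_map hF (by fun_prop), Measure.lintegral_compProd hF,
    ← Kernel.traj_map_frestrictLe_apply, lintegral_map hF.lintegral_kernel_prod_right'
      (Preorder.measurable_frestrictLe t)] at hlaw
  exact hlaw.symm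

variable {Q} {V f : Z → ℝ} {r β : ℝ}

theorem WeightedFeller.lintegral_weight_le (hV : WeightedFeller Q V r) (z₀ : Z) (t : ℕ) :
    ∫⁻ ω, ENNReal.ofReal (V (ω t)) ∂pathLaw Q z₀ ≤ ENNReal.ofReal (r ^ t * V z₀) := by
  have hmeas : Measurable fun z => ENNReal.ofReal (V z) :=
    hV.continuous_weight.measurable.ennreal_ofReal
  induction t with
  | zero =>
    rw [lintegral_congr_ae ((pathLaw_start Q z₀).mono fun ω hω =>
      congrArg (fun z => ENNReal.ofReal (V z)) hω), lintegral_const, measure_univ, mul_one,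
      pow_zero, one_mul]
  | succ t ih =>
    calc ∫⁻ ω, ENNReal.ofReal (V (ω (t + 1))) ∂pathLaw Q z₀
        = ∫⁻ ω, ∫⁻ z, ENNReal.ofReal (V z) ∂Q (ω t) ∂pathLaw Q z₀ :=
          lintegral_pathLaw_succ Q z₀ t (F := fun _ z => ENNReal.ofReal (V z))
            (hmeas.comp measurable_snd)
      _ ≤ ∫⁻ ω, ENNReal.ofReal r * ENNReal.ofReal (V (ω t)) ∂pathLaw Q z₀ := by
          refine lintegral_mono fun ω => ?_
          rw [← ofReal_integral_eq_lintegral_ofReal (hV.integrable_weight _)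
            (.of_forall fun z => (hV.weight_pos z).le), ← ENNReal.ofReal_mul hV.rate_nonneg]
          exact ENNReal.ofReal_le_ofReal (hV.drift _)
      _ = ENNReal.ofReal r * ∫⁻ ω, ENNReal.ofReal (V (ω t)) ∂pathLaw Q z₀ :=
          lintegral_const_mul _ (hmeas.comp (measurable_pi_apply t))
      _ ≤ ENNReal.ofReal r * ENNReal.ofReal (r ^ t * V z₀) := by gcongr
      _ = ENNReal.ofReal (r ^ (t + 1) * V z₀) := by
          rw [← ENNReal.ofReal_mul hV.rate_nonneg, pow_succ', mul_assoc]

theorem WeightedFeller.tsum_lintegral_ne_top (hV : WeightedFeller Q V r) (hβ : 0 ≤ β)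
    (hβr : β * r < 1) (hf : Dominated V f) (z₀ : Z) :
    ∑' t, ENNReal.ofReal β ^ t * ∫⁻ ω, ENNReal.ofReal (f (ω t)) ∂pathLaw Q z₀ ≠ ⊤ := by
  obtain ⟨K, hK, hfK⟩ := hf.exists_le
  have hterm (t : ℕ) : ENNReal.ofReal β ^ t * ∫⁻ ω, ENNReal.ofReal (f (ω t)) ∂pathLaw Q z₀
      ≤ ENNReal.ofReal (K * V z₀ * (β * r) ^ t) :=
    calc ENNReal.ofReal β ^ t * ∫⁻ ω, ENNReal.ofReal (f (ω t)) ∂pathLaw Q z₀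
        ≤ ENNReal.ofReal β ^ t *
            ∫⁻ ω, ENNReal.ofReal K * ENNReal.ofReal (V (ω t)) ∂pathLaw Q z₀ := by
          gcongr with ω
          rw [← ENNReal.ofReal_mul hK]
          exact ENNReal.ofReal_le_ofReal (hfK _)
      _ ≤ ENNReal.ofReal β ^ t * (ENNReal.ofReal K * ENNReal.ofReal (r ^ t * V z₀)) := by
          rw [lintegral_const_mul' _ _ ENNReal.ofReal_ne_top]
          gcongr
          exact hV.lintegral_weight_le z₀ t
      _ = ENNReal.ofReal (K * V z₀ * (β * r) ^ t) := by
          rw [← ENNReal.ofReal_pow hβ, ← ENNReal.ofReal_mul hK,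
            ← ENNReal.ofReal_mul (pow_nonneg hβ t)]
          ring_nf
  have hgeom : Summable fun t : ℕ => K * V z₀ * (β * r) ^ t :=
    (summable_geometric_of_lt_one (mul_nonneg hβ hV.rate_nonneg) hβr).mul_left _
  exact ne_top_of_le_ne_top hgeom.tsum_ofReal_ne_top (ENNReal.tsum_le_tsum hterm)

end PathLaw

section Plans

variable {Q : Kernel Z Z} [IsMarkovKernel Q] {z₀ : Z} {β : ℝ} {u : ℝ → ℝ} {x₀ : Fin k → ℝ}
  {p : Z → Fin k → ℝ} {π : Plan Z}

/-- Expected utility `E u(c_t)` of period `t`. -/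
noncomputable def Plan.periodUtility (π : Plan Z) (u : ℝ → ℝ) (Q : Kernel Z Z) [IsMarkovKernel Q]
    (z₀ : Z) (t : ℕ) : ℝ≥0∞ :=
  ∫⁻ ω, ENNReal.ofReal (u (π.cons t (history t ω))) ∂pathLaw Q z₀

/-- Expected value, at the state-dependent asset values `ψ`, of the portfolio with which the
consumer enters period `t`. -/
noncomputable def Plan.wealth (π : Plan Z) (x₀ : Fin k → ℝ) (ψ : Fin k → Z → ℝ) (Q : Kernel Z Z)
    [IsMarkovKernel Q] (z₀ : Z) (t : ℕ) : ℝ≥0∞ :=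
  ∫⁻ ω, ENNReal.ofReal (∑ i, π.entering x₀ t (history t ω) i * ψ i (ω t)) ∂pathLaw Q z₀

theorem Plan.Feasible.utility_eq_tsum (hπ : π.Feasible p x₀ z₀) (hu : ContinuousOn u (Ici 0))
    (hβ : 0 ≤ β) :
    π.utility β u Q z₀ = ∑' t, ENNReal.ofReal β ^ t * π.periodUtility u Q z₀ t := by
  have hmax : Continuous fun c : ℝ => u (max c 0) :=
    hu.comp_continuous (by fun_prop) fun c => le_max_right c 0
  have hmeas (t : ℕ) : AEMeasurable
      (fun ω => ENNReal.ofReal (u (π.cons t (history t ω)))) (pathLaw Q z₀) := by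
    refine ⟨fun ω => ENNReal.ofReal (u (max (π.cons t (history t ω)) 0)),
      (hmax.measurable.comp ((hπ.measurable_cons t).comp (by fun_prop))).ennreal_ofReal, ?_⟩
    filter_upwards [pathLaw_start Q z₀] with ω hω
    rw [max_eq_left (hπ.cons_nonneg t _ hω)]
  simp only [Plan.utility, ENNReal.ofReal_mul (pow_nonneg hβ _), ENNReal.ofReal_pow hβ]
  rw [lintegral_tsum fun t => (hmeas t).const_mul _]
  exact tsum_congr fun t =>
    lintegral_const_mul' _ _ (ENNReal.pow_ne_top ENNReal.ofReal_ne_top)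

theorem clearingPlan_entering (t : ℕ) (h : Finset.Iic t → Z) :
    (clearingPlan Z).entering (fun _ => 1) t h = fun _ => 1 := by
  cases t <;> rfl

theorem clearingPlan_feasible (hZ : ∀ z ∈ Z, ∀ i, 0 ≤ z i) (p : Z → Fin k → ℝ) (z₀ : Z) :
    (clearingPlan Z).Feasible p (fun _ => 1) z₀ where
  measurable_cons _ := continuous_total.measurable.comp
    (measurable_subtype_coe.comp (measurable_pi_apply _))
  measurable_hold _ := measurable_const
  cons_nonneg _ _ _ := total_nonneg (hZ _ (Subtype.prop _))
  hold_nonneg _ _ _ _ := zero_le_one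
  budget t h _ := by
    rw [clearingPlan_entering]
    simp only [clearingPlan, total, one_mul, Finset.sum_add_distrib, le_refl]

theorem lintegral_portfolio_succ {t : ℕ} {x : (Finset.Iic t → Z) → Fin k → ℝ} (hx : Measurable x)
    (hx0 : ∀ᵐ ω ∂pathLaw Q z₀, ∀ i, 0 ≤ x (history t ω) i) (hβ : 0 ≤ β) {φ ψ : Fin k → Z → ℝ}
    (hψm : ∀ i, Measurable (ψ i)) (hψ0 : ∀ i z, 0 ≤ ψ i z) (hψi : ∀ i z, Integrable (ψ i) (Q z))
    (hφ : ∀ i z, φ i z = β * ∫ z', ψ i z' ∂Q z) :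
    ENNReal.ofReal β *
        ∫⁻ ω, ENNReal.ofReal (∑ i, x (history t ω) i * ψ i (ω (t + 1))) ∂pathLaw Q z₀
      = ∫⁻ ω, ENNReal.ofReal (∑ i, x (history t ω) i * φ i (ω t)) ∂pathLaw Q z₀ := by
  have hmeas : Measurable (Function.uncurry fun (h : Finset.Iic t → Z) z =>
      ENNReal.ofReal (∑ i, x h i * ψ i z)) :=
    (Finset.measurable_sum _ fun i _ => (((measurable_pi_apply i).comp hx).comp
      measurable_fst).mul ((hψm i).comp measurable_snd)).ennreal_ofReal
  rw [lintegral_pathLaw_succ Q z₀ t (F := fun h z => ENNReal.ofReal (∑ i, x h i * ψ i z)) hmeas,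
    ← lintegral_const_mul' _ _ ENNReal.ofReal_ne_top]
  refine lintegral_congr_ae (hx0.mono fun ω hω => ?_)
  have hint (i : Fin k) : Integrable (fun z => x (history t ω) i * ψ i z) (Q (ω t)) :=
    (hψi i _).const_mul _
  have hvalue : β * ∫ z, ∑ i, x (history t ω) i * ψ i z ∂Q (ω t)
      = ∑ i, x (history t ω) i * φ i (ω t) := by
    rw [integral_finsetSum _ fun i _ => hint i, Finset.mul_sum]
    refine Finset.sum_congr rfl fun i _ => ?_
    rw [integral_const_mul, hφ, mul_left_comm]
  beta_reduce
  rw [← hvalue, ENNReal.ofReal_mul hβ, ofReal_integral_eq_lintegral_ofReal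
    (integrable_finsetSum _ fun i _ => hint i)
    (.of_forall fun z => Finset.sum_nonneg fun i _ => mul_nonneg (hω i) (hψ0 i z))]

/-- Telescoping `C t + X (t + 1) - I (t + 1) ≤ Y t + X t - I t`, with both sides moved so that no
subtraction occurs in `[0, ∞]`. -/
theorem tsum_le_tsum_of_telescoping {C X Y I : ℕ → ℝ≥0∞}
    (hstep : ∀ t, C t + X (t + 1) + I t ≤ Y t + X t + I (t + 1)) (hzero : X 0 ≤ I 0)
    (hI : ∀ t, I t ≠ ⊤) (hlim : Tendsto I atTop (𝓝 0)) : ∑' t, C t ≤ ∑' t, Y t := by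
  have hpartial (T : ℕ) :
      ∑ t ∈ Finset.range T, C t + X T ≤ ∑ t ∈ Finset.range T, Y t + I T := by
    induction T with
    | zero => simpa only [Finset.range_zero, Finset.sum_empty, zero_add] using hzero
    | succ T ih =>
      rw [Finset.sum_range_succ, Finset.sum_range_succ]
      refine (ENNReal.add_le_add_iff_right (hI T)).1 ?_
      calc ∑ t ∈ Finset.range T, C t + C T + X (T + 1) + I T
          = ∑ t ∈ Finset.range T, C t + (C T + X (T + 1) + I T) := by ring
        _ ≤ ∑ t ∈ Finset.range T, C t + (Y T + X T + I (T + 1)) :=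
            add_le_add_right (hstep T) _
        _ = (∑ t ∈ Finset.range T, C t + X T) + (Y T + I (T + 1)) := by ring
        _ ≤ (∑ t ∈ Finset.range T, Y t + I T) + (Y T + I (T + 1)) := add_le_add_left ih _
        _ = ∑ t ∈ Finset.range T, Y t + Y T + I (T + 1) + I T := by ring
  have hbound := (ENNReal.tendsto_nat_tsum Y).add hlim
  rw [add_zero] at hbound
  exact le_of_tendsto_of_tendsto' (ENNReal.tendsto_nat_tsum C) hbound fun T =>
    le_self_add.trans (hpartial T)

end Plans

section Equilibrium

/-- The price `p_i = φ_i / u'(𝟏ᵀz)`, for which `φ_i` is the utility value of asset `i`. -/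
noncomputable def price (u : ℝ → ℝ) (φ : Fin k → Z → ℝ) (z : Z) (i : Fin k) : ℝ :=
  φ i z / marginal u (total (z : Fin k → ℝ))

/-- The utility value of asset `i` before its current dividend is paid out. -/
noncomputable def cumValue (u : ℝ → ℝ) (φ : Fin k → Z → ℝ) (i : Fin k) (z : Z) : ℝ :=
  marginalPayoff u i z + φ i z

variable {Q : Kernel Z Z} {V : Z → ℝ} {r β : ℝ} {u : ℝ → ℝ} {φ : Fin k → Z → ℝ}

theorem SolvesLucas.eq_integral_cumValue (hφ : SolvesLucas β u Q φ) (i : Fin k) (z : Z) :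
    φ i z = β * ∫ z', cumValue u φ i z' ∂Q z := by
  obtain ⟨hpayoff, hint, heq⟩ := hφ i z
  exact heq.trans ((mul_add _ _ _).symm.trans
    (congrArg (β * ·) (integral_add hpayoff hint).symm))

theorem IsUtility.add_values_le_of_budget (hu : IsUtility u) (hZ : ∀ z ∈ Z, ∀ i, 0 ≤ z i) {z : Z}
    {c : ℝ} (hc : 0 ≤ c) {x y : Fin k → ℝ}
    (hbudget : c + ∑ i, y i * price u φ z i ≤
      ∑ i, x i * ((z : Fin k → ℝ) i + price u φ z i)) :
    u c + ∑ i, y i * φ i z + ∑ i, cumValue u φ i z ≤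
      u (total (z : Fin k → ℝ)) + ∑ i, x i * cumValue u φ i z + ∑ i, φ i z := by
  have hpos := hu.marginal_total_pos hZ z
  have htangent := hu.le_tangent hc (total_nonneg (hZ z z.2))
  have hφ (i : Fin k) : φ i z = marginal u (total (z : Fin k → ℝ)) * price u φ z i :=
    (mul_div_cancel₀ _ hpos.ne').symm
  have hbought : ∑ i, y i * φ i z
      = marginal u (total (z : Fin k → ℝ)) * ∑ i, y i * price u φ z i := by
    rw [Finset.mul_sum]
    exact Finset.sum_congr rfl fun i _ => by rw [hφ, mul_left_comm]
  have hbrought : ∑ i, x i * cumValue u φ i z = marginal u (total (z : Fin k → ℝ)) *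
      ∑ i, x i * ((z : Fin k → ℝ) i + price u φ z i) := by
    rw [Finset.mul_sum]
    exact Finset.sum_congr rfl fun i _ => by rw [cumValue, marginalPayoff, hφ]; ring
  have hcum : ∑ i, cumValue u φ i z
      = marginal u (total (z : Fin k → ℝ)) * total (z : Fin k → ℝ) + ∑ i, φ i z := by
    simp only [cumValue, marginalPayoff, Finset.sum_add_distrib, ← Finset.sum_mul]
    rw [mul_comm, total]
  rw [hbought, hbrought, hcum]
  linarith [mul_le_mul_of_nonneg_left hbudget hpos.le]

theorem dominated_cumValue (hpayoff : ∀ i, Dominated V (marginalPayoff (Z := Z) u i))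
    (hφ : ∀ i, Dominated V (φ i)) (i : Fin k) : Dominated V (cumValue u φ i) :=
  (hpayoff i).add (hφ i)

variable [IsMarkovKernel Q] {z₀ : Z} {π : Plan Z}

theorem Plan.Feasible.mul_wealth_succ (hπ : π.Feasible (price u φ) (fun _ => 1) z₀)
    (hV : WeightedFeller Q V r) (hβ : 0 ≤ β) (hcum : ∀ i, Dominated V (cumValue u φ i))
    (hφ : SolvesLucas β u Q φ) (t : ℕ) :
    ENNReal.ofReal β * π.wealth (fun _ => 1) (cumValue u φ) Q z₀ (t + 1)
      = ∫⁻ ω, ENNReal.ofReal (∑ i, π.hold t (history t ω) i * φ i (ω t)) ∂pathLaw Q z₀ :=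
  lintegral_portfolio_succ (hπ.measurable_hold t)
    ((pathLaw_start Q z₀).mono fun _ hω => hπ.hold_nonneg t _ hω) hβ
    (fun i => (hcum i).continuous.measurable) (fun i => (hcum i).nonneg)
    (fun i => hV.integrable (hcum i)) hφ.eq_integral_cumValue

theorem clearingPlan_periodUtility (u : ℝ → ℝ) (t : ℕ) :
    (clearingPlan Z).periodUtility u Q z₀ t
      = ∫⁻ ω, ENNReal.ofReal (u (total (ω t : Fin k → ℝ))) ∂pathLaw Q z₀ :=
  rfl

theorem clearingPlan_wealth (u : ℝ → ℝ) (φ : Fin k → Z → ℝ) (t : ℕ) :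
    (clearingPlan Z).wealth (fun _ => 1) (cumValue u φ) Q z₀ t
      = ∫⁻ ω, ENNReal.ofReal (∑ i, cumValue u φ i (ω t)) ∂pathLaw Q z₀ := by
  simp only [Plan.wealth, clearingPlan_entering, one_mul]

theorem Plan.Feasible.periodUtility_add_wealth_le
    (hπ : π.Feasible (price u φ) (fun _ => 1) z₀) (hV : WeightedFeller Q V r) (hβ : 0 ≤ β)
    (hZ : ∀ z ∈ Z, ∀ i, 0 ≤ z i) (hu : IsUtility u)
    (hpayoff : ∀ i, Dominated V (marginalPayoff (Z := Z) u i))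
    (hdom : ∀ i, Dominated V (φ i)) (hφ : SolvesLucas β u Q φ) (t : ℕ) :
    π.periodUtility u Q z₀ t
        + ENNReal.ofReal β * π.wealth (fun _ => 1) (cumValue u φ) Q z₀ (t + 1)
        + (clearingPlan Z).wealth (fun _ => 1) (cumValue u φ) Q z₀ t ≤
      (clearingPlan Z).periodUtility u Q z₀ t + π.wealth (fun _ => 1) (cumValue u φ) Q z₀ t
        + ENNReal.ofReal β *
          (clearingPlan Z).wealth (fun _ => 1) (cumValue u φ) Q z₀ (t + 1) := by
  have hcum := dominated_cumValue hpayoff hdom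
  have hYmeas : Measurable fun ω : ℕ → Z => ENNReal.ofReal (u (total (ω t : Fin k → ℝ))) :=
    ((hu.continuous_comp_total hZ).measurable.comp (measurable_pi_apply t)).ennreal_ofReal
  have hφmeas : Measurable fun ω : ℕ → Z => ENNReal.ofReal (∑ i, φ i (ω t)) :=
    (Finset.measurable_sum _ fun i _ =>
      (hdom i).continuous.measurable.comp (measurable_pi_apply t)).ennreal_ofReal
  rw [hπ.mul_wealth_succ hV hβ hcum hφ,
    (clearingPlan_feasible hZ _ z₀).mul_wealth_succ hV hβ hcum hφ, clearingPlan_wealth,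
    clearingPlan_periodUtility]
  simp only [clearingPlan, one_mul]
  unfold Plan.periodUtility Plan.wealth
  rw [← lintegral_add_left hYmeas, ← lintegral_add_right _ hφmeas]
  refine (add_le_add_left (le_lintegral_add _ _) _).trans ((le_lintegral_add _ _).trans
    (lintegral_mono_ae ?_))
  filter_upwards [pathLaw_start Q z₀] with ω hω
  have hc := hπ.cons_nonneg t (history t ω) hω
  have hbought : 0 ≤ ∑ i, π.hold t (history t ω) i * φ i (ω t) :=
    Finset.sum_nonneg fun i _ => mul_nonneg (hπ.hold_nonneg t _ hω i) ((hdom i).nonneg _)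
  rw [← ENNReal.ofReal_add (hu.nonneg hc) hbought,
    ← ENNReal.ofReal_add (add_nonneg (hu.nonneg hc) hbought)
      (Finset.sum_nonneg fun i _ => (hcum i).nonneg _)]
  exact (ENNReal.ofReal_le_ofReal
    (hu.add_values_le_of_budget hZ hc (hπ.budget t (history t ω) hω))).trans
      (ENNReal.ofReal_add_le.trans (add_le_add_left ENNReal.ofReal_add_le _))

theorem clearingPlan_optimal (hV : WeightedFeller Q V r) (hβ : 0 ≤ β) (hβr : β * r < 1)
    (hZ : ∀ z ∈ Z, ∀ i, 0 ≤ z i) (hu : IsUtility u)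
    (huV : Dominated V fun z : Z => u (total (z : Fin k → ℝ)))
    (hpayoff : ∀ i, Dominated V (marginalPayoff (Z := Z) u i))
    (hdom : ∀ i, Dominated V (φ i)) (hφ : SolvesLucas β u Q φ) (z₀ : Z) :
    (clearingPlan Z).Optimal β u Q (price u φ) (fun _ => 1) z₀ := by
  have hfeas := clearingPlan_feasible hZ (price u φ) z₀
  have hcont := hu.contDiffOn.continuousOn
  have hwealth : ∑' t, ENNReal.ofReal β ^ t *
      (clearingPlan Z).wealth (fun _ => 1) (cumValue u φ) Q z₀ t ≠ ⊤ := by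
    simp only [clearingPlan_wealth]
    exact hV.tsum_lintegral_ne_top hβ hβr (.sum _ (dominated_cumValue hpayoff hdom)) z₀
  refine ⟨hfeas, ?_, fun π hπ => ?_⟩
  · rw [hfeas.utility_eq_tsum hcont hβ]
    exact hV.tsum_lintegral_ne_top hβ hβr huV z₀
  · rw [hπ.utility_eq_tsum hcont hβ, hfeas.utility_eq_tsum hcont hβ]
    refine tsum_le_tsum_of_telescoping
      (X := fun t => ENNReal.ofReal β ^ t * π.wealth (fun _ => 1) (cumValue u φ) Q z₀ t)
      (fun t => ?_) le_rfl (ENNReal.ne_top_of_tsum_ne_top hwealth)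
      (ENNReal.tendsto_atTop_zero_of_tsum_ne_top hwealth)
    simp only [pow_succ, mul_assoc, ← mul_add]
    gcongr _ * ?_
    exact hπ.periodUtility_add_wealth_le hV hβ hZ hu hpayoff hdom hφ t

end Equilibrium

section AffineDividends

variable {Q : Kernel Z Z} {ν : Measure (Fin k → ℝ)} {c d : Z → Fin k → ℝ}

/-- Dividends follow `z_{i,t+1} = c_i(z_t) + d_i(z_t) w_{i,t+1}` with i.i.d. nonnegative shocks of
law `ν` with finite expectation; this is the common form of the linear and log-linear models. -/
structure AffineDividends (Q : Kernel Z Z) (ν : Measure (Fin k → ℝ)) (c d : Z → Fin k → ℝ) :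
    Prop where
  continuous_intercept : Continuous c
  continuous_slope : Continuous d
  shock_nonneg : ∀ᵐ w ∂ν, 0 ≤ w
  integrable_shock : ∀ i, Integrable (fun w : Fin k → ℝ => w i) ν
  map_eq : ∀ z : Z, (Q z).map Subtype.val = ν.map fun w => c z + d z * w

theorem measurable_affine (a b : Fin k → ℝ) : Measurable fun w : Fin k → ℝ => a + b * w := by
  fun_prop

namespace AffineDividends

theorem ae_mem (hQ : AffineDividends Q ν c d) (hZm : MeasurableSet Z) (z : Z) :
    ∀ᵐ w ∂ν, c z + d z * w ∈ Z := by
  refine ae_of_ae_map (p := (· ∈ Z)) (measurable_affine (c z) (d z)).aemeasurable ?_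
  rw [← hQ.map_eq z, (MeasurableEmbedding.subtype_coe hZm).ae_map_iff]
  exact .of_forall Subtype.prop

theorem integral_eq (hQ : AffineDividends Q ν c d) (hZm : MeasurableSet Z)
    {g : (Fin k → ℝ) → ℝ} (hg : Measurable g) (z : Z) :
    ∫ z' : Z, g z' ∂Q z = ∫ w, g (c z + d z * w) ∂ν := by
  rw [← (MeasurableEmbedding.subtype_coe hZm).integral_map, hQ.map_eq,
    integral_map (measurable_affine _ _).aemeasurable hg.aestronglyMeasurable]

variable [IsProbabilityMeasure ν]

theorem integrable_dotProduct (hQ : AffineDividends Q ν c d) (A a b : Fin k → ℝ) :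
    Integrable (fun w => A ⬝ᵥ (a + b * w)) ν :=
  integrable_finsetSum _ fun i _ =>
    ((integrable_const (a i)).add ((hQ.integrable_shock i).const_mul (b i))).const_mul (A i)

theorem integral_dotProduct (hQ : AffineDividends Q ν c d) (A a b : Fin k → ℝ) :
    ∫ w, A ⬝ᵥ (a + b * w) ∂ν = A ⬝ᵥ (a + b * fun i => ∫ w, w i ∂ν) := by
  have hshock (i : Fin k) : Integrable (fun w : Fin k → ℝ => b i * w i) ν :=
    (hQ.integrable_shock i).const_mul (b i)
  have hterm (i : Fin k) : Integrable (fun w : Fin k → ℝ => A i * (a i + b i * w i)) ν :=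
    ((integrable_const (a i)).add (hshock i)).const_mul (A i)
  simp only [dotProduct, Pi.add_apply, Pi.mul_apply]
  rw [integral_finsetSum _ fun i _ => hterm i]
  refine Finset.sum_congr rfl fun i _ => ?_
  rw [integral_const_mul, integral_add (integrable_const _) (hshock i), integral_const_mul,
    integral_const, probReal_univ, one_smul]

theorem continuous_integral (hQ : AffineDividends Q ν c d) (hZm : MeasurableSet Z)
    {A : Fin k → ℝ} (hA : 0 ≤ A) {b : ℝ} {f : Z → ℝ} (hf : Continuous f)
    (hfA : ∀ z : Z, |f z| ≤ A ⬝ᵥ (z : Fin k → ℝ) + b) :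
    Continuous fun z => ∫ z', f z' ∂Q z := by
  set g : (Fin k → ℝ) → ℝ := Function.extend Subtype.val f 0
  have hgf (z : Z) : g z = f z := Subtype.val_injective.extend_apply f 0 z
  have hg : Measurable g :=
    (MeasurableEmbedding.subtype_coe hZm).measurable_extend hf.measurable measurable_const
  have hint (z : Z) : ∫ z', f z' ∂Q z = ∫ w, g (c z + d z * w) ∂ν := by
    rw [← hQ.integral_eq hZm hg z]
    simp only [hgf]
  simp only [hint]
  -- Sequences are needed: `c z + d z * w` lies in `Z` only off a `ν`-null set depending on `z`.
  refine continuous_iff_seqContinuous.2 fun s z hs => ?_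
  have hc := (hQ.continuous_intercept.tendsto z).comp hs
  have hd := (hQ.continuous_slope.tendsto z).comp hs
  obtain ⟨M, hM⟩ := hc.bddAbove_range
  obtain ⟨N, hN⟩ := hd.bddAbove_range
  refine tendsto_integral_of_dominated_convergence (fun w => A ⬝ᵥ (M + N * w) + b)
    (fun n => (hg.comp (measurable_affine _ _)).aestronglyMeasurable)
    ((hQ.integrable_dotProduct A M N).add (integrable_const b)) (fun n => ?_) ?_
  · filter_upwards [hQ.shock_nonneg, hQ.ae_mem hZm (s n)] with w hw hmem
    calc ‖g (c (s n) + d (s n) * w)‖ = |f ⟨_, hmem⟩| := congrArg abs (hgf ⟨_, hmem⟩)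
      _ ≤ A ⬝ᵥ (c (s n) + d (s n) * w) + b := hfA ⟨_, hmem⟩
      _ ≤ A ⬝ᵥ (M + N * w) + b := add_le_add_left (dotProduct_le_dotProduct_of_nonneg_left
          (add_le_add (hM ⟨n, rfl⟩) (mul_le_mul_of_nonneg_right (hN ⟨n, rfl⟩) hw)) hA) b
  · filter_upwards [hQ.ae_mem hZm z, ae_all_iff.2 fun n => hQ.ae_mem hZm (s n)] with w hz hsn
    have hstate : Tendsto (fun n => (⟨_, hsn n⟩ : Z)) atTop (𝓝 ⟨_, hz⟩) :=
      tendsto_subtype_rng.2 (hc.add (hd.mul_const w))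
    have hlim := (hf.tendsto _).comp hstate
    rw [← hgf] at hlim
    exact hlim.congr fun n => (hgf _).symm

theorem weightedFeller (hQ : AffineDividends Q ν c d) (hZm : MeasurableSet Z)
    (hZ : ∀ z ∈ Z, ∀ i, 0 ≤ z i) {A : Fin k → ℝ} (hA : 0 ≤ A) {b r : ℝ} (hb : 1 ≤ b) (hr : 0 ≤ r)
    (hdrift : ∀ z : Z, A ⬝ᵥ (c z + d z * fun i => ∫ w, w i ∂ν) + b
      ≤ r * (A ⬝ᵥ (z : Fin k → ℝ) + b)) :
    WeightedFeller Q (fun z => A ⬝ᵥ (z : Fin k → ℝ) + b) r := by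
  have hcont : Continuous fun x : Fin k → ℝ => A ⬝ᵥ x + b := by fun_prop
  have hone (z : Z) : 1 ≤ A ⬝ᵥ (z : Fin k → ℝ) + b :=
    le_add_of_nonneg_of_le (dotProduct_nonneg_of_nonneg hA (hZ z z.2)) hb
  have hint (z : Z) : Integrable (fun w => A ⬝ᵥ (c z + d z * w) + b) ν :=
    (hQ.integrable_dotProduct A _ _).add (integrable_const b)
  refine ⟨hcont.comp continuous_subtype_val, hone, hr, fun z => ?_, fun z => ?_,
    fun f hf K hfK => hQ.continuous_integral hZm (smul_nonneg (abs_nonneg K) hA) hf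
      (b := |K| * b) fun z => ?_⟩
  · have hmap : Integrable (fun x => A ⬝ᵥ x + b) ((Q z).map Subtype.val) := by
      rw [hQ.map_eq, integrable_map_measure hcont.measurable.aestronglyMeasurable
        (measurable_affine _ _).aemeasurable]
      exact hint z
    exact (MeasurableEmbedding.subtype_coe hZm).integrable_map_iff.1 hmap
  · rw [hQ.integral_eq hZm (g := fun x => A ⬝ᵥ x + b) hcont.measurable,
      integral_add (hQ.integrable_dotProduct A _ _) (integrable_const b),
      hQ.integral_dotProduct, integral_const, probReal_univ, one_smul]
    exact hdrift z
  · rw [smul_dotProduct, smul_eq_mul, ← mul_add]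
    exact (hfK z).trans
      (mul_le_mul_of_nonneg_right (le_abs_self K) (zero_le_one.trans (hone z)))

end AffineDividends

/-- The transition function `Q` has the weighted Feller property for an affine weight `Aᵀz + b`
that dominates the aggregate dividend and grows on average more slowly than `1 / β` per period. -/
def HasAffineWeight (β : ℝ) (Q : Kernel Z Z) : Prop :=
  ∃ (A : Fin k → ℝ) (b r : ℝ), 1 ≤ A ∧ 0 ≤ b ∧ β * r < 1 ∧
    WeightedFeller Q (fun z => A ⬝ᵥ (z : Fin k → ℝ) + b) r

theorem AffineDividends.hasAffineWeight [IsProbabilityMeasure ν] (hQ : AffineDividends Q ν c d)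
    (hZm : MeasurableSet Z) (hZ : ∀ z ∈ Z, ∀ i, 0 ≤ z i) {A : Fin k → ℝ} (hA : 1 ≤ A) {β : ℝ}
    (hβ : β ∈ Ioo 0 1) {r₀ C : ℝ} (hβr₀ : β * r₀ < 1)
    (hdrift : ∀ z : Z, A ⬝ᵥ (c z + d z * fun i => ∫ w, w i ∂ν)
      ≤ r₀ * (A ⬝ᵥ (z : Fin k → ℝ)) + C) :
    HasAffineWeight β Q := by
  have hrate : max r₀ 1 < 1 / β :=
    max_lt ((lt_div_iff₀' hβ.1).2 hβr₀) ((one_lt_div hβ.1).2 hβ.2)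
  obtain ⟨r, hr, hrβ⟩ := exists_between hrate
  obtain ⟨hr₀r, hr1⟩ := max_lt_iff.1 hr
  have hA0 : 0 ≤ A := zero_le_one.trans hA
  -- A rate above 1 leaves room to absorb the constant `C` into the affine term `b`.
  set b := max 1 (C / (r - 1))
  have hb : 1 ≤ b := le_max_left _ _
  have hCb : C ≤ b * (r - 1) := (div_le_iff₀ (sub_pos.2 hr1)).1 (le_max_right _ _)
  refine ⟨A, b, r, hA, zero_le_one.trans hb, (lt_div_iff₀' hβ.1).1 hrβ,
    hQ.weightedFeller hZm hZ hA0 hb (zero_le_one.trans hr1.le) fun z => ?_⟩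
  have hAz : 0 ≤ A ⬝ᵥ (z : Fin k → ℝ) := dotProduct_nonneg_of_nonneg hA0 (hZ z z.2)
  linarith [hdrift z, mul_le_mul_of_nonneg_right hr₀r.le hAz]

end AffineDividends

section LinearDividends

theorem exists_pos_mul_norm_le {E : Type*} [NormedAddCommGroup E] [NormedSpace ℝ E]
    [FiniteDimensional ℝ E] (N : Seminorm ℝ E) (hN : ∀ x, N x = 0 → x = 0) :
    ∃ κ > 0, ∀ x, κ * ‖x‖ ≤ N x := by
  have hcont : Continuous N := N.convexOn.locallyLipschitz.continuous
  obtain ⟨κ, hκ, hκN⟩ := (isCompact_sphere (0 : E) 1).exists_forall_le' hcont.continuousOn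
    (a := 0) fun x hx => (apply_nonneg N x).lt_of_ne' fun h =>
      ne_zero_of_mem_unit_sphere ⟨x, hx⟩ (hN x h)
  refine ⟨κ, hκ, fun x => ?_⟩
  rcases eq_or_ne x 0 with rfl | hx
  · rw [norm_zero, mul_zero, map_zero]
  have hxpos : 0 < ‖x‖ := norm_pos_iff.2 hx
  have hunit : κ ≤ N (‖x‖⁻¹ • x) := hκN _ (by
    rw [mem_sphere_zero_iff_norm, norm_smul, norm_inv, norm_norm, inv_mul_cancel₀ hxpos.ne'])
  rwa [map_smul_eq_mul, norm_inv, norm_norm, inv_mul_eq_div, le_div_iff₀ hxpos] at hunit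

theorem tendsto_iterate_zero_of_seminorm_le {E : Type*} [NormedAddCommGroup E] [NormedSpace ℝ E]
    [FiniteDimensional ℝ E] (N : Seminorm ℝ E) (hN : ∀ x, N x = 0 → x = 0) {f : E → E} {q : ℝ}
    (hq : q < 1) (hf : ∀ x, N (f x) ≤ q * N x) (x : E) :
    Tendsto (fun n => f^[n] x) atTop (𝓝 0) := by
  obtain ⟨κ, hκ, hκN⟩ := exists_pos_mul_norm_le N hN
  have hiterate (n : ℕ) : N (f^[n] x) ≤ max q 0 ^ n * N x := by
    induction n with
    | zero => rw [Function.iterate_zero_apply, pow_zero, one_mul]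
    | succ n ih =>
      rw [Function.iterate_succ_apply', pow_succ', mul_assoc]
      exact (hf _).trans (mul_le_mul (le_max_left _ _) ih (apply_nonneg _ _) (le_max_right _ _))
  have hlim : Tendsto (fun n => max q 0 ^ n * N x / κ) atTop (𝓝 0) := by
    have := ((tendsto_pow_atTop_nhds_zero_of_lt_one (le_max_right q 0)
      (max_lt hq one_pos)).mul_const (N x)).div_const κ
    rwa [zero_mul, zero_div] at this
  exact squeeze_zero_norm
    (fun n => (le_div_iff₀' hκ).2 ((hκN _).trans (hiterate n))) hlim

theorem exists_one_le_vecMul_le {ι : Type*} [Fintype ι] [DecidableEq ι] {B : Matrix ι ι ℝ}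
    (hB : ∀ i j, 0 ≤ B i j) (hlim : ∀ x, Tendsto (fun n => (B ^ n) *ᵥ x) atTop (𝓝 0)) :
    ∃ A : ι → ℝ, 1 ≤ A ∧ A ᵥ* B ≤ A := by
  have hpow (n : ℕ) : 0 ≤ (1 : ι → ℝ) ᵥ* B ^ n := fun j =>
    dotProduct_nonneg_of_nonneg zero_le_one fun i => Matrix.pow_apply_nonneg hB n i j
  have hcol (j : ι) : Tendsto (fun n => ((1 : ι → ℝ) ᵥ* B ^ n) j) atTop (𝓝 0) := by
    have := tendsto_finsetSum Finset.univ fun i _ => tendsto_pi_nhds.1 (hlim (Pi.single j 1)) i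
    simpa [Matrix.vecMul, dotProduct] using this
  obtain ⟨m, hm, hmpos⟩ := ((eventually_all.2 fun j =>
    (hcol j).eventually_le_const one_pos).and (eventually_ge_atTop 1)).exists
  refine ⟨∑ n ∈ Finset.range m, 1 ᵥ* B ^ n, ?_, ?_⟩
  · calc (1 : ι → ℝ) = 1 ᵥ* B ^ 0 := by rw [pow_zero, Matrix.vecMul_one]
      _ ≤ ∑ n ∈ Finset.range m, 1 ᵥ* B ^ n :=
        Finset.single_le_sum (fun n _ => hpow n) (Finset.mem_range.2 hmpos)
  · refine le_of_add_le_add_right (a := 1) ?_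
    calc (∑ n ∈ Finset.range m, 1 ᵥ* B ^ n) ᵥ* B + 1
        = ∑ n ∈ Finset.range m, 1 ᵥ* B ^ (n + 1) + 1 ᵥ* B ^ 0 := by
          simp only [Matrix.sum_vecMul, Matrix.vecMul_vecMul, ← pow_succ, pow_zero,
            Matrix.vecMul_one]
      _ = ∑ n ∈ Finset.range m, 1 ᵥ* B ^ n + 1 ᵥ* B ^ m := by
          rw [← Finset.sum_range_succ' (fun n => (1 : ι → ℝ) ᵥ* B ^ n), Finset.sum_range_succ]
      _ ≤ ∑ n ∈ Finset.range m, 1 ᵥ* B ^ n + 1 := add_le_add_right hm _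

theorem LinearDividends.hasAffineWeight {Q : Kernel Z Z} (hQ : LinearDividends Q)
    (hZm : MeasurableSet Z) (hZ : ∀ z ∈ Z, ∀ i, 0 ≤ z i) {β : ℝ} (hβ : β ∈ Ioo 0 1) :
    HasAffineWeight β Q := by
  obtain ⟨B, ν, hν, hB, ⟨N, hN, q, hq, hBN⟩, hshock, hint, hmap⟩ := hQ
  have hpow (x : Fin k → ℝ) : Tendsto (fun n => (B ^ n) *ᵥ x) atTop (𝓝 0) := by
    have hiterate (n : ℕ) : (B ^ n) *ᵥ x = (fun y => B *ᵥ y)^[n] x := by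
      rw [← Matrix.toLin'_apply, Matrix.toLin'_pow, Module.End.pow_apply]
      rfl
    simpa only [hiterate] using tendsto_iterate_zero_of_seminorm_le N hN hq hBN x
  obtain ⟨A, hA, hAB⟩ := exists_one_le_vecMul_le hB hpow
  have haffine : AffineDividends Q ν (fun z => B *ᵥ (z : Fin k → ℝ)) 1 :=
    ⟨continuous_const.matrix_mulVec continuous_subtype_val, continuous_const, hshock, hint,
      fun z => by simpa only [Pi.one_apply, one_mul] using hmap z⟩
  refine haffine.hasAffineWeight hZm hZ hA hβ (r₀ := 1) (C := A ⬝ᵥ fun i => ∫ w, w i ∂ν)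
    ((mul_one β).trans_lt hβ.2) fun z => ?_
  rw [Pi.one_apply, one_mul, one_mul, dotProduct_add, Matrix.dotProduct_mulVec]
  exact add_le_add_left (dotProduct_le_dotProduct_of_nonneg_right hAB (hZ z z.2)) _

end LinearDividends

section LogLinearDividends

theorem exists_rpow_mul_le_affine {ρ : ℝ} (hρ0 : 0 ≤ ρ) (hρ1 : ρ < 1) (m : ℝ) {ε : ℝ}
    (hε : 0 < ε) : ∃ C, ∀ x, 0 ≤ x → x ^ ρ * m ≤ ε * x + C := by
  have hm : 0 < |m| + 1 := by positivity
  set η := ε / (|m| + 1)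
  have hη : 0 < η := div_pos hε hm
  set y := η ^ (-ρ / (1 - ρ))
  have hy : 0 ≤ y := Real.rpow_nonneg hη.le _
  have hy_pow : y ^ (1 - ρ) = (η ^ ρ)⁻¹ := by
    rw [← Real.rpow_mul hη.le, div_mul_cancel₀ _ (sub_pos.2 hρ1).ne', Real.rpow_neg hη.le]
  refine ⟨(|m| + 1) * y, fun x hx => ?_⟩
  have hyoung : x ^ ρ ≤ η * x + y :=
    calc x ^ ρ = (η * x) ^ ρ * y ^ (1 - ρ) := by
          rw [hy_pow, Real.mul_rpow hη.le hx, mul_right_comm,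
            mul_inv_cancel₀ (Real.rpow_pos_of_pos hη ρ).ne', one_mul]
      _ ≤ ρ * (η * x) + (1 - ρ) * y :=
          Real.geom_mean_le_arith_mean2_weighted hρ0 (sub_nonneg.2 hρ1.le)
            (mul_nonneg hη.le hx) hy (add_sub_cancel _ _)
      _ ≤ η * x + y := add_le_add (mul_le_of_le_one_left (mul_nonneg hη.le hx) hρ1.le)
          (mul_le_of_le_one_left hy (sub_le_self 1 hρ0))
  calc x ^ ρ * m ≤ x ^ ρ * (|m| + 1) := mul_le_mul_of_nonneg_left
        ((le_abs_self m).trans (le_add_of_nonneg_right zero_le_one)) (Real.rpow_nonneg hx ρ)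
    _ ≤ (η * x + y) * (|m| + 1) := mul_le_mul_of_nonneg_right hyoung hm.le
    _ = η * (|m| + 1) * x + (|m| + 1) * y := by ring
    _ = ε * x + (|m| + 1) * y := by rw [div_mul_cancel₀ _ hm.ne']

theorem LogLinearDividends.hasAffineWeight {Q : Kernel Z Z} {β : ℝ}
    (hQ : LogLinearDividends β Q) (hZm : MeasurableSet Z) (hZ : ∀ z ∈ Z, ∀ i, 0 ≤ z i)
    (hβ : β ∈ Ioo 0 1) : HasAffineWeight β Q := by
  obtain ⟨ρ, ν, hν, hρ, hshock, hint, hmean, hmap⟩ := hQ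
  obtain ⟨r₀, hr₀, hmean_le, hr₀β⟩ :
      ∃ r₀ > 0, (∀ i, ρ i = 1 → ∫ w, w i ∂ν ≤ r₀) ∧ r₀ < 1 / β := by
    have hle : ∀ᶠ r in 𝓝[<] (1 / β), ∀ i, ρ i = 1 → ∫ w, w i ∂ν ≤ r :=
      eventually_all.2 fun i => eventually_imp_distrib_left.2 fun hi =>
        (eventually_ge_nhds (hmean i hi)).filter_mono nhdsWithin_le_nhds
    exact (((eventually_gt_nhds (one_div_pos.2 hβ.1)).filter_mono nhdsWithin_le_nhds).and
      (hle.and self_mem_nhdsWithin)).exists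
  have hdrift (i : Fin k) : ∃ C, ∀ x, 0 ≤ x → x ^ ρ i * ∫ w, w i ∂ν ≤ r₀ * x + C := by
    rcases (hρ i).2.eq_or_lt with hi | hi
    · refine ⟨0, fun x hx => ?_⟩
      rw [hi, Real.rpow_one, add_zero, mul_comm]
      exact mul_le_mul_of_nonneg_right (hmean_le i hi) hx
    · exact exists_rpow_mul_le_affine (hρ i).1 hi _ hr₀
  choose C hC using hdrift
  have haffine : AffineDividends Q ν 0 fun z i => (z : Fin k → ℝ) i ^ ρ i :=
    ⟨continuous_const, continuous_pi fun i =>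
        ((continuous_apply i).comp continuous_subtype_val).rpow_const fun _ => .inr (hρ i).1,
      hshock.mono fun w hw i => zero_le_one.trans (hw i), hint, fun z => by
        simp only [hmap z, Pi.zero_apply, zero_add]; rfl⟩
  refine haffine.hasAffineWeight hZm hZ le_rfl hβ (C := ∑ i, C i)
    ((lt_div_iff₀' hβ.1).1 hr₀β) fun z => ?_
  rw [Pi.zero_apply, zero_add, one_dotProduct, one_dotProduct, Finset.mul_sum,
    ← Finset.sum_add_distrib]
  exact Finset.sum_le_sum fun i _ => hC i _ (hZ z z.2 i)

end LogLinearDividends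

section Existence

variable {Q : Kernel Z Z} {V : Z → ℝ} {β r : ℝ} {u : ℝ → ℝ}

theorem WeightedFeller.exists_solvesLucas (hV : WeightedFeller Q V r) (hβ : 0 ≤ β)
    (hβr : β * r < 1) (hg : ∀ i, Dominated V (marginalPayoff u i)) :
    ∃ φ : Fin k → Z → ℝ, (∀ i, Dominated V (φ i)) ∧ SolvesLucas β u Q φ := by
  choose φ hdom hφ using fun i => hV.exists_dominated_eq_add_integral hβ hβr
    ((hV.dominated_integral (hg i)).const_mul hβ)
  exact ⟨φ, hdom, fun i z => ⟨hV.integrable (hg i) z, hV.integrable (hdom i) z, hφ i z⟩⟩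

theorem total_le_dotProduct_add {z A : Fin k → ℝ} (hz : ∀ i, 0 ≤ z i) (hA : 1 ≤ A) {b : ℝ}
    (hb : 0 ≤ b) : total z ≤ A ⬝ᵥ z + b :=
  calc total z = 1 ⬝ᵥ z := (one_dotProduct z).symm
    _ ≤ A ⬝ᵥ z := dotProduct_le_dotProduct_of_nonneg_right hA hz
    _ ≤ A ⬝ᵥ z + b := le_add_of_nonneg_right hb

theorem isEquilibriumPrice_price [IsMarkovKernel Q] (hV : WeightedFeller Q V r) (hβ : 0 ≤ β)
    (hβr : β * r < 1) (hZ : ∀ z ∈ Z, ∀ i, 0 ≤ z i) (hu : IsUtility u)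
    (huV : Dominated V fun z : Z => u (total (z : Fin k → ℝ)))
    (hg : ∀ i, Dominated V (marginalPayoff u i)) {φ : Fin k → Z → ℝ}
    (hdom : ∀ i, Dominated V (φ i)) (hφ : SolvesLucas β u Q φ) :
    IsEquilibriumPrice β u Q (price u φ) where
  continuous := continuous_pi fun i => (hdom i).continuous.div
    (hu.continuous_marginal_total hZ) fun z => (hu.marginal_total_pos hZ z).ne'
  nonneg z i := div_nonneg ((hdom i).nonneg z) (hu.marginal_total_pos hZ z).le
  optimal := clearingPlan_optimal hV hβ hβr hZ hu huV hg hdom hφ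

theorem Dominated.exists_price_le {φ : Fin k → Z → ℝ} (hdom : ∀ i, Dominated V (φ i)) {a : ℝ}
    (ha : 0 < a) (hu : ∀ z ∈ Z, a ≤ marginal u (total z)) :
    ∃ K : Fin k → ℝ, 0 ≤ K ∧ ∀ z i, price u φ z i ≤ K i * V z := by
  choose L hL hφL using fun i => (hdom i).exists_le
  refine ⟨fun i => L i / a, fun i => div_nonneg (hL i) ha.le, fun z i => ?_⟩
  calc φ i z / marginal u (total (z : Fin k → ℝ)) ≤ φ i z / a :=
        div_le_div_of_nonneg_left ((hdom i).nonneg z) ha (hu z z.2)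
    _ ≤ L i * V z / a := div_le_div_of_nonneg_right (hφL i z) ha.le
    _ = L i / a * V z := (div_mul_eq_mul_div _ _ _).symm

end Existence

end Lucas

theorem theorem7_general {k : ℕ} {Z : Set (Fin k → ℝ)} (hZ : ∀ z ∈ Z, ∀ i, 0 ≤ z i)
    {β : ℝ} (hβ : 0 ≤ β) {u : ℝ → ℝ} (hu : Lucas.IsUtility u) {γ δ : ℝ}
    (hγδ : ∀ c, 0 ≤ c → c * Lucas.marginal u c ≤ γ * c + δ) {a : ℝ} (ha : 0 < a)
    (hua : ∀ z ∈ Z, a ≤ Lucas.marginal u (Lucas.total z)) (Q : Kernel Z Z) [IsMarkovKernel Q]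
    (hQ : Lucas.HasAffineWeight β Q) :
    ∃ (φ : Fin k → Z → ℝ) (p : Z → Fin k → ℝ),
      Lucas.SolvesLucas β u Q φ ∧
      (∀ z i, p z i = φ i z / Lucas.marginal u (Lucas.total (z : Fin k → ℝ))) ∧
      Lucas.IsEquilibriumPrice β u Q p ∧
      ∃ (A : Fin k → Fin k → ℝ) (b : Fin k → ℝ),
        (∀ i j, 0 ≤ A i j) ∧ (∀ i, 0 < b i) ∧
        ∀ (z : Z) i, p z i ≤ ∑ j, A i j * (z : Fin k → ℝ) j + b i := by
  obtain ⟨A, b, r, hA, hb, hβr, hV⟩ := hQ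
  have hVtotal (z : Z) := Lucas.total_le_dotProduct_add (hZ z z.2) hA hb
  have huV := hu.dominated_comp_total hZ hV.one_le hVtotal
  have hg := hu.dominated_marginalPayoff hZ hV.one_le hVtotal hγδ
  obtain ⟨φ, hdom, hφ⟩ := hV.exists_solvesLucas hβ hβr hg
  obtain ⟨K, hK, hle⟩ := Lucas.Dominated.exists_price_le hdom ha hua
  refine ⟨φ, Lucas.price u φ, hφ, fun _ _ => rfl,
    Lucas.isEquilibriumPrice_price hV hβ hβr hZ hu huV hg hdom hφ,
    fun i => K i • A, fun i => K i * b + 1,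
    fun i j => mul_nonneg (hK i) (zero_le_one.trans (hA j)),
    fun i => add_pos_of_nonneg_of_pos (mul_nonneg (hK i) hb) one_pos, fun z i => ?_⟩
  calc Lucas.price u φ z i ≤ K i * (A ⬝ᵥ z + b) := hle z i
    _ = (K i • A) ⬝ᵥ z + K i * b := by rw [mul_add, smul_dotProduct, smul_eq_mul]
    _ ≤ (K i • A) ⬝ᵥ z + (K i * b + 1) := by gcongr; exact le_add_of_nonneg_right zero_le_one

theorem theorem7 {k : ℕ} (Z : Set (Fin k → ℝ)) (hZm : MeasurableSet Z)
    (hZ : ∀ z ∈ Z, ∀ i, 0 ≤ z i)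
    (β : ℝ) (hβ : β ∈ Set.Ioo (0 : ℝ) 1)
    (u : ℝ → ℝ) (hu0 : u 0 = 0)
    (hu1 : ContDiffOn ℝ 1 u (Set.Ici 0))
    (hu2 : ∀ c, 0 ≤ c → 0 < Lucas.marginal u c)
    (hu3 : StrictConcaveOn ℝ (Set.Ici 0) u)
    (γ δ : ℝ) (hγ : 0 ≤ γ) (hδ : 0 ≤ δ)
    (hu4 : ∀ c, 0 ≤ c → c * Lucas.marginal u c ≤ γ * c + δ)
    (a : ℝ) (ha : 0 < a)
    (hu5 : ∀ z ∈ Z, a ≤ Lucas.marginal u (Lucas.total z))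
    (Q : ProbabilityTheory.Kernel Z Z) [ProbabilityTheory.IsMarkovKernel Q]
    (hQ : Lucas.LinearDividends Q ∨ Lucas.LogLinearDividends β Q) :
    ∃ (φ : Fin k → Z → ℝ) (p : Z → Fin k → ℝ),
      Lucas.SolvesLucas β u Q φ ∧
      (∀ z i, p z i = φ i z / Lucas.marginal u (Lucas.total (z : Fin k → ℝ))) ∧
      Lucas.IsEquilibriumPrice β u Q p ∧
      ∃ (A : Fin k → Fin k → ℝ) (b : Fin k → ℝ),
        (∀ i j, 0 ≤ A i j) ∧ (∀ i, 0 < b i) ∧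
        ∀ (z : Z) i, p z i ≤ ∑ j, A i j * (z : Fin k → ℝ) j + b i :=
  theorem7_general hZ hβ.1.le ⟨hu0.ge, hu1, hu3.concaveOn, hu2⟩ hu4 ha hu5 Q
    (hQ.elim (·.hasAffineWeight hZm hZ hβ) (·.hasAffineWeight hZm hZ hβ))
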